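/- Let $\Omega\subset\mathbb{R}^d$ be closed. For a closed set $S\subset\mathbb{R}^d$, $x\in S$ and $y\in\mathbb{R}^d$ put $P_S(y)=\{z\in S:|z-y|=\inf_{w\in S}|w-y|\}$, $N^P(S,x)=\{v\in\mathbb{R}^d:\exists\alpha>0,\ x\in P_S(x+\alpha v)\}$, and let the Clarke tangent cone $T(S,x)$ be the set of all $v\in\mathbb{R}^d$ such that for all $t_k\to0$ with $t_k>0$ and all $y_k\in S$ with $y_k\to x$ there are $v_k\to v$ with $y_k+t_kv_k\in S$ for every $k$. For $w\in\mathbb{R}^d$ let $P_x(w)$ be the unique point of the closed convex cone $T(\Omega,x)$ nearest to $w$. Assume that $\Omega$ is $\eta$-prox-regular for some $\eta>0$, that is, $B_\eta(x+\eta v)\cap\Omega=\emptyset$ for all $x\in\partial\Omega$ and all $v\in N^P(\Omega,x)$ with $|v|=1$, where $B_\eta(y)$ is the open ball. Let $W,V\in C^1(\mathbb{R}^d)$, and for $A\subset\mathbb{R}^d$ write $\mathrm{Conv}(A)=\{\theta x+(1-\theta)y:x,y\in A,\ 0\le\theta\le1\}$. Suppose that at least one of the following holds. 1. $\Omega$ is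 bounded, and there are $\lambda_W,\lambda_V\in\mathbb{R}$ such that $f(y)\ge f(x)+\langle\nabla f(x),y-x\rangle+\frac{\lambda}{2}|y-x|^2$ for all $x,y\in K$, both for $(f,\lambda,K)=(W,\lambda_W,\mathrm{Conv}(\Omega-\Omega))$ and for $(f,\lambda,K)=(V,\lambda_V,\mathrm{Conv}(\Omega))$. 2. $\nabla W$ and $\nabla V$ have linear growth: there is $C>0$ with $|\nabla W(x)|\le C(1+|x|)$ and $|\nabla V(x)|\le C(1+|x|)$ for all $x\in\mathbb{R}^d$. Then for every $n\in\mathbb{N}$, every $(a_1,\dots,a_n)\in\Omega^n$ and all $m_1,\dots,m_n\ge0$ with $\sum_{i=1}^n m_i=1$, there is a curve $x=(x_1(\cdot),\dots,x_n(\cdot)):[0,\infty)\to\Omega^n$, absolutely continuous on every $[0,T]$, such that $x_i(0)=a_i$ for every $i$ and, for almost every $t\ge0$ and every $i=1,\dots,n$, $$\dot x_i(t)=P_{x_i(t)}\Big(-\sum_{j=1}^n m_j\nabla W\big(x_i(t)-x_j(t)\big)-\nabla V\big(x_i(t)\big)\Big).$$ -/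

import Mathlib

open Set Filter Topology MeasureTheory
open scoped Gradient RealInnerProductSpace Pointwise

namespace ProxFlow

/-- `d`-dimensional Euclidean space. -/
abbrev Space (d : ℕ) : Type := EuclideanSpace ℝ (Fin d)

/-- The (set-valued) projection onto `S`: all points of `S` nearest to `y`. -/
def nearest {d : ℕ} (S : Set (Space d)) (y : Space d) : Set (Space d) :=
  {z | z ∈ S ∧ ‖z - y‖ = ⨅ w : S, ‖(w : Space d) - y‖}

/-- The proximal normal cone to `S` at `x` (it is empty for `x ∉ S`). -/
def proxNormalCone {d : ℕ} (S : Set (Space d)) (x : Space d) : Set (Space d) :=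
  {v | ∃ α : ℝ, 0 < α ∧ x ∈ nearest S (x + α • v)}

/-- `S` is closed and `η`-prox-regular. -/
structure IsProxRegular {d : ℕ} (η : ℝ) (S : Set (Space d)) : Prop where
  isClosed : IsClosed S
  ball_inter : ∀ x ∈ frontier S, ∀ v ∈ proxNormalCone S x, ‖v‖ = 1 →
    Metric.ball (x + η • v) η ∩ S = ∅

/-- The Clarke tangent cone to `S` at a point `x ∈ S`. -/
def clarkeTangentCone {d : ℕ} (S : Set (Space d)) (x : Space d) : Set (Space d) :=
  {v | ∀ (t : ℕ → ℝ) (y : ℕ → Space d),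
    (∀ k, 0 < t k) → Tendsto t atTop (𝓝 0) →
    (∀ k, y k ∈ S) → Tendsto y atTop (𝓝 x) →
    ∃ u : ℕ → Space d, Tendsto u atTop (𝓝 v) ∧ ∀ k, y k + t k • u k ∈ S}

/-- The projection of the velocity `w` onto the tangent cone to `S` at `x`, as a set of
nearest points; `tangentProj S x w = {v}` says that `v` is the projection of `w`. -/
def tangentProj {d : ℕ} (S : Set (Space d)) (x w : Space d) : Set (Space d) :=
  nearest (clarkeTangentCone S x) w

/-- All points `θ x + (1 - θ) y` with `x, y ∈ A` and `0 ≤ θ ≤ 1`. This set is contained in the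
convex hull of `A`. -/
def conv {d : ℕ} (A : Set (Space d)) : Set (Space d) :=
  {z | ∃ x ∈ A, ∃ y ∈ A, ∃ θ : ℝ, 0 ≤ θ ∧ θ ≤ 1 ∧ z = θ • x + (1 - θ) • y}

/-- The inequality of `lam`-geodesic convexity on `S`, for a differentiable function `f`. -/
def GeodConvexOn {d : ℕ} (lam : ℝ) (f : Space d → ℝ) (S : Set (Space d)) : Prop :=
  ∀ x ∈ S, ∀ y ∈ S, f x + ⟪∇ f x, y - x⟫ + lam / 2 * ‖y - x‖ ^ 2 ≤ f y

/-- The gradient of `f` has at most linear growth. -/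
def GradLinearGrowth {d : ℕ} (f : Space d → ℝ) : Prop :=
  ∃ C : ℝ, 0 < C ∧ ∀ x, ‖∇ f x‖ ≤ C * (1 + ‖x‖)

/-- The unconstrained velocity of the `i`-th particle in the configuration `x`. -/
noncomputable def velocity {d n : ℕ} (W V : Space d → ℝ) (m : Fin n → ℝ)
    (x : Fin n → Space d) (i : Fin n) : Space d :=
  -(∑ j, m j • ∇ W (x i - x j)) - ∇ V (x i)

/-- `x` (regarded on `[0, ∞)` only) is a locally absolutely continuous solution in `Ω ^ n` of the
projected particle system with initial configuration `x₀`. -/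
structure IsSolution {d n : ℕ} (Ω : Set (Space d)) (W V : Space d → ℝ) (m : Fin n → ℝ)
    (x₀ : Fin n → Space d) (x : ℝ → Fin n → Space d) : Prop where
  locallyAC : ∀ i, ∀ T : ℝ, 0 ≤ T → AbsolutelyContinuousOnInterval (fun t => x t i) 0 T
  mem : ∀ t : ℝ, 0 ≤ t → ∀ i, x t i ∈ Ω
  initial : x 0 = x₀
  ode : ∀ᵐ t ∂(volume.restrict (Ici (0 : ℝ))), ∀ i, ∃ v : Space d,
    HasDerivAt (fun s => x s i) v t ∧
      tangentProj Ω (x t i) (velocity W V m (x t) i) = {v}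

end ProxFlow

/-! The solution is a limit of the catching-up scheme: follow the field `F` for a time `h`, then
return to a nearest point of `Ω`. The correction is a proximal normal, and prox-regularity
(`IsProxRegular.inner_le`) makes it satisfy `⟪w, y - x⟫ ≤ C * ‖y - x‖ ^ 2` for every `y ∈ Ω`. Being
global in `y`, this inequality survives limits. It yields a discrete evolution variational
inequality, hence in the limit (`IsProxRegular.exists_curve`) a locally Lipschitz curve for which `F
- v` obeys such an inequality wherever the velocity `v` exists.

To recognise `v` as the projection of `F`, note that a curve staying in `Ω` has velocity orthogonal
to all these normals. By Clarke regularity (`IsProxRegular.mem_clarkeTangentCone`) `v` is then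
tangent, and orthogonality to `F - v` gives the variational inequality of the projection. Existence
needs only continuity of `F` and the bound `‖F x i‖ ≤ A * (1 + ‖x‖)` on `Ω ^ n`, which either
alternative supplies. -/

namespace ProxFlow

/-! ### Proximal normals, Clarke tangents and tangential projections -/

section Geometry

variable {d : ℕ} {S : Set (Space d)}

theorem mem_nearest_iff {y z : Space d} :
    z ∈ nearest S y ↔ z ∈ S ∧ ∀ w ∈ S, ‖z - y‖ ≤ ‖w - y‖ := by
  have hbdd : BddBelow (range fun w : S => ‖(w : Space d) - y‖) :=
    ⟨0, by rintro _ ⟨w, rfl⟩; exact norm_nonneg _⟩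
  constructor
  · rintro ⟨hz, h⟩
    exact ⟨hz, fun w hw => h ▸ ciInf_le hbdd ⟨w, hw⟩⟩
  · rintro ⟨hz, h⟩
    have : Nonempty S := ⟨⟨z, hz⟩⟩
    exact ⟨hz, le_antisymm (le_ciInf fun w => h w w.2) (ciInf_le hbdd ⟨z, hz⟩)⟩

theorem exists_mem_nearest (hS : IsClosed S) (hne : S.Nonempty) (y : Space d) :
    ∃ z, z ∈ nearest S y := by
  obtain ⟨z, hz, h⟩ := hS.exists_infDist_eq_dist hne y
  refine ⟨z, mem_nearest_iff.2 ⟨hz, fun w hw => ?_⟩⟩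
  rw [← dist_eq_norm, ← dist_eq_norm, dist_comm, ← h, dist_comm]
  exact Metric.infDist_le_dist_of_mem hw

/-- A point which is nearest to a point different from itself is a boundary point. -/
theorem mem_frontier_of_mem_nearest {x w : Space d} (hx : x ∈ nearest S (x + w)) (hw : w ≠ 0) :
    x ∈ frontier S := by
  rw [mem_nearest_iff] at hx
  refine ⟨subset_closure hx.1, fun hint => ?_⟩
  -- From an interior point a short step towards `x + w` stays in `S` and comes strictly closer.
  have hc : Tendsto (fun s : ℝ => x + s • w) (𝓝[>] 0) (𝓝 x) := by
    have : Continuous fun s : ℝ => x + s • w := by fun_prop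
    simpa using (this.tendsto 0).mono_left nhdsWithin_le_nhds
  have h1 := hc.eventually (mem_interior_iff_mem_nhds.1 hint)
  have h2 : ∀ᶠ s : ℝ in 𝓝[>] 0, s ∈ Ioo (0 : ℝ) 1 := Ioo_mem_nhdsGT one_pos
  obtain ⟨s, hs, hs0, hs1⟩ := (h1.and h2).exists
  have h3 := hx.2 _ hs
  have e1 : x - (x + w) = -w := by abel
  have e2 : x + s • w - (x + w) = (s - 1) • w := by rw [sub_smul, one_smul]; abel
  rw [e1, e2, norm_neg, norm_smul, Real.norm_eq_abs, abs_of_neg (by linarith)] at h3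
  nlinarith [norm_pos_iff.2 hw]

/-- The quadratic inequality satisfied by the proximal normals of a prox-regular set. -/
theorem IsProxRegular.inner_le {η : ℝ} (hη : 0 < η) (hS : IsProxRegular η S) {x w y : Space d}
    (hx : x ∈ nearest S (x + w)) (hy : y ∈ S) :
    ⟪w, y - x⟫ ≤ ‖w‖ / (2 * η) * ‖y - x‖ ^ 2 := by
  rcases eq_or_ne w 0 with rfl | hw
  · simp
  have hw' : 0 < ‖w‖ := norm_pos_iff.2 hw
  have hb := hS.ball_inter x (mem_frontier_of_mem_nearest hx hw) (‖w‖⁻¹ • w)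
    ⟨‖w‖, hw', by rwa [smul_smul, mul_inv_cancel₀ hw'.ne', one_smul]⟩
    (by rw [norm_smul, norm_inv, norm_norm, inv_mul_cancel₀ hw'.ne'])
  -- `y` lies outside the ball of radius `η` touching at `x`; expanding the square gives the claim.
  have h1 : η ≤ ‖(y - x) - (η * ‖w‖⁻¹) • w‖ := by
    by_contra! hlt
    have : y ∈ Metric.ball (x + η • ‖w‖⁻¹ • w) η ∩ S := by
      refine ⟨?_, hy⟩
      rw [Metric.mem_ball, dist_eq_norm, smul_smul, ← sub_sub]
      exact hlt
    rw [hb] at this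
    exact this
  have h2 : η ^ 2 ≤ ‖(y - x) - (η * ‖w‖⁻¹) • w‖ ^ 2 := pow_le_pow_left₀ hη.le h1 2
  rw [norm_sub_sq_real, norm_smul, inner_smul_right, real_inner_comm, Real.norm_eq_abs,
    abs_of_pos (by positivity), inv_mul_cancel_right₀ hw'.ne'] at h2
  have h3 : 2 * (η * ‖w‖⁻¹ * ⟪w, y - x⟫) ≤ ‖y - x‖ ^ 2 := by linarith
  calc ⟪w, y - x⟫ = ‖w‖ / (2 * η) * (2 * (η * ‖w‖⁻¹ * ⟪w, y - x⟫)) := by field_simp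
    _ ≤ _ := mul_le_mul_of_nonneg_left h3 (by positivity)

/-- Clarke tangent vectors have nonpositive product with proximal normals. -/
theorem inner_nonpos_of_mem_clarkeTangentCone {x u w : Space d} {C : ℝ} (hx : x ∈ S)
    (hw : ∀ y ∈ S, ⟪w, y - x⟫ ≤ C * ‖y - x‖ ^ 2) (hu : u ∈ clarkeTangentCone S x) :
    ⟪w, u⟫ ≤ 0 := by
  have ht : Tendsto (fun k : ℕ => 1 / ((k : ℝ) + 1)) atTop (𝓝 0) :=
    tendsto_one_div_add_atTop_nhds_zero_nat
  obtain ⟨v, hv, hmem⟩ := hu _ (fun _ => x) (fun k => by positivity) ht (fun _ => hx)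
    tendsto_const_nhds
  have h1 : Tendsto (fun k => ⟪w, v k⟫) atTop (𝓝 ⟪w, u⟫) := tendsto_const_nhds.inner hv
  have h2 : Tendsto (fun k : ℕ => C * (1 / ((k : ℝ) + 1) * ‖v k‖ ^ 2)) atTop
      (𝓝 (C * (0 * ‖u‖ ^ 2))) := (ht.mul (hv.norm.pow 2)).const_mul C
  rw [zero_mul, mul_zero] at h2
  refine le_of_tendsto_of_tendsto' h1 h2 fun k => ?_
  have h3 := hw _ (hmem k)
  have hk : 0 < 1 / ((k : ℝ) + 1) := by positivity
  set s := 1 / ((k : ℝ) + 1)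
  rw [add_sub_cancel_left, inner_smul_right, norm_smul, Real.norm_eq_abs, abs_of_pos hk] at h3
  refine le_of_mul_le_mul_left ?_ hk
  linarith

/-- A prox-regular set is Clarke regular: the polar of the proximal normals is contained in the
Clarke tangent cone. -/
theorem IsProxRegular.mem_clarkeTangentCone {η : ℝ} (hη : 0 < η) (hS : IsProxRegular η S)
    {x v : Space d}
    (hv : ∀ (w : Space d) (C : ℝ), (∀ y ∈ S, ⟪w, y - x⟫ ≤ C * ‖y - x‖ ^ 2) → ⟪w, v⟫ ≤ 0) :
    v ∈ clarkeTangentCone S x := by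
  intro t y ht0 ht hy hyx
  have hne : S.Nonempty := ⟨y 0, hy 0⟩
  choose z hz using fun k => exists_mem_nearest hS.isClosed hne (y k + t k • v)
  -- Tangency amounts to the projection error `e k` of `y k + t k • v` being `o(t k)`.
  have hz' := fun k => mem_nearest_iff.1 (hz k)
  set e : ℕ → Space d := fun k => y k + t k • v - z k with he
  have he_le : ∀ k, ‖e k‖ ≤ t k * ‖v‖ := fun k => by
    have := (hz' k).2 _ (hy k)
    rw [sub_add_cancel_left, norm_neg, norm_smul, Real.norm_eq_abs, abs_of_pos (ht0 k),
      norm_sub_rev] at this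
    exact this
  have htv : Tendsto (fun k => t k * ‖v‖) atTop (𝓝 0) := by simpa using ht.mul_const ‖v‖
  have he0 : Tendsto e atTop (𝓝 0) := squeeze_zero_norm he_le htv
  have hzx : Tendsto z atTop (𝓝 x) := by
    have h := (hyx.add (ht.smul_const v)).sub he0
    simp only [zero_smul, add_zero, sub_zero] at h
    refine h.congr fun k => ?_
    simp [he]
  have hprox : ∀ k, ∀ q ∈ S, ⟪e k, q - z k⟫ ≤ ‖e k‖ / (2 * η) * ‖q - z k‖ ^ 2 := fun k q hq =>
    hS.inner_le hη (by rw [he]; simpa using hz k) hq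
  have hratio : Tendsto (fun k => ‖e k‖ / t k) atTop (𝓝 0) := by
    rw [Metric.tendsto_atTop]
    -- Otherwise the normalised errors accumulate at some `w`. In the limit `w` keeps the quadratic
    -- inequality at `x`, so `⟪w, v⟫ ≤ 0`; but testing the inequality at `z k` with the point `y k`
    -- forces `ε ≤ ⟪w, v⟫`.
    by_contra! hcon
    obtain ⟨ε, hε, hcon⟩ := hcon
    choose φ hφ_ge hφ using hcon
    have hφt : Tendsto φ atTop atTop := tendsto_atTop_mono hφ_ge tendsto_id
    have hφ' : ∀ k, ε * t (φ k) ≤ ‖e (φ k)‖ := fun k => by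
      have := hφ k
      rw [Real.dist_eq, sub_zero, abs_of_nonneg (div_nonneg (norm_nonneg _) (ht0 _).le),
        le_div_iff₀ (ht0 _)] at this
      exact this
    have hpos : ∀ k, 0 < ‖e (φ k)‖ := fun k => (mul_pos hε (ht0 _)).trans_le (hφ' k)
    have hsph : ∀ k, ‖e (φ k)‖⁻¹ • e (φ k) ∈ Metric.closedBall (0 : Space d) 1 := fun k => by
      rw [mem_closedBall_zero_iff, norm_smul, norm_inv, norm_norm, inv_mul_cancel₀ (hpos k).ne']
    obtain ⟨w, -, ψ, hψ, hw⟩ := (isCompact_closedBall (0 : Space d) 1).tendsto_subseq hsph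
    have hφψ : Tendsto (fun k => φ (ψ k)) atTop atTop := hφt.comp hψ.tendsto_atTop
    have hwn : ⟪w, v⟫ ≤ 0 := by
      refine hv w (1 / (2 * η)) fun q hq => ?_
      have hq' : Tendsto (fun k => q - z (φ (ψ k))) atTop (𝓝 (q - x)) :=
        tendsto_const_nhds.sub (hzx.comp hφψ)
      refine le_of_tendsto_of_tendsto' (hw.inner hq') ((hq'.norm.pow 2).const_mul _) fun k => ?_
      have h := hprox (φ (ψ k)) q hq
      simp only [Function.comp_apply, real_inner_smul_left]
      calc ‖e (φ (ψ k))‖⁻¹ * ⟪e (φ (ψ k)), q - z (φ (ψ k))⟫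
          ≤ ‖e (φ (ψ k))‖⁻¹ * (‖e (φ (ψ k))‖ / (2 * η) * ‖q - z (φ (ψ k))‖ ^ 2) :=
            mul_le_mul_of_nonneg_left h (inv_nonneg.2 (norm_nonneg _))
        _ = _ := by
          have := (hpos (ψ k)).ne'
          field_simp
    have hlim : Tendsto (fun k => ⟪‖e (φ (ψ k))‖⁻¹ • e (φ (ψ k)), v⟫ +
        t (φ (ψ k)) * (2 * ‖v‖ ^ 2 / η)) atTop (𝓝 (⟪w, v⟫ + 0 * (2 * ‖v‖ ^ 2 / η))) :=
      (hw.inner tendsto_const_nhds).add ((ht.comp hφψ).mul_const _)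
    have hge : ε ≤ ⟪w, v⟫ + 0 * (2 * ‖v‖ ^ 2 / η) := by
      refine ge_of_tendsto' hlim fun k => ?_
      set j := φ (ψ k)
      have hj : 0 < ‖e j‖ := hpos (ψ k)
      have htj := ht0 j
      have h := hprox j (y j) (hy j)
      have e1 : y j - z j = e j - t j • v := by simp only [he]; abel
      rw [e1, inner_sub_right, real_inner_self_eq_norm_sq, inner_smul_right] at h
      have e2 : ‖e j - t j • v‖ ≤ 2 * (t j * ‖v‖) := by
        refine (norm_sub_le _ _).trans ?_
        rw [norm_smul, Real.norm_eq_abs, abs_of_pos htj]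
        linarith [he_le j]
      have e3 : ‖e j - t j • v‖ ^ 2 ≤ (2 * (t j * ‖v‖)) ^ 2 :=
        pow_le_pow_left₀ (norm_nonneg _) e2 2
      have e4 : ‖e j‖ / (2 * η) * ‖e j - t j • v‖ ^ 2 ≤
          ‖e j‖ / (2 * η) * (2 * (t j * ‖v‖)) ^ 2 :=
        mul_le_mul_of_nonneg_left e3 (by positivity)
      have e5 : ‖e j‖ * (ε * t j) ≤ ‖e j‖ ^ 2 := by
        rw [sq]; exact mul_le_mul_of_nonneg_left (hφ' (ψ k)) hj.le
      have e6 : (‖e j‖ * t j) * ε ≤ (‖e j‖ * t j) *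
          (‖e j‖⁻¹ * ⟪e j, v⟫ + t j * (2 * ‖v‖ ^ 2 / η)) := by
        have : (‖e j‖ * t j) * (‖e j‖⁻¹ * ⟪e j, v⟫ + t j * (2 * ‖v‖ ^ 2 / η)) =
            t j * ⟪e j, v⟫ + ‖e j‖ / (2 * η) * (2 * (t j * ‖v‖)) ^ 2 := by
          field_simp
        rw [this]
        linarith
      rw [real_inner_smul_left]
      exact le_of_mul_le_mul_left e6 (mul_pos hj htj)
    linarith
  refine ⟨fun k => (t k)⁻¹ • (z k - y k), ?_, fun k => ?_⟩
  · have h : Tendsto (fun k => (t k)⁻¹ • e k) atTop (𝓝 0) := by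
      refine squeeze_zero_norm (fun k => le_of_eq ?_) hratio
      rw [norm_smul, norm_inv, Real.norm_eq_abs, abs_of_pos (ht0 k), div_eq_inv_mul]
    have h' := (tendsto_const_nhds (x := v)).sub h
    rw [sub_zero] at h'
    refine h'.congr fun k => ?_
    have hk := (ht0 k).ne'
    simp only [he, smul_sub, smul_add, smul_smul, inv_mul_cancel₀ hk, one_smul]
    abel
  · simpa only [smul_smul, mul_inv_cancel₀ (ht0 k).ne', one_smul, add_sub_cancel] using (hz' k).1

/-- The obtuse-angle condition gives `‖v - w‖ ^ 2 + ‖u - v‖ ^ 2 ≤ ‖u - w‖ ^ 2`, hence minimality and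
uniqueness at once, without appeal to convexity of the cone. -/
theorem tangentProj_eq_singleton {x w v : Space d} (hv : v ∈ clarkeTangentCone S x)
    (h : ∀ u ∈ clarkeTangentCone S x, ⟪w - v, u - v⟫ ≤ 0) : tangentProj S x w = {v} := by
  have key : ∀ u ∈ clarkeTangentCone S x, ‖v - w‖ ^ 2 + ‖u - v‖ ^ 2 ≤ ‖u - w‖ ^ 2 := by
    intro u hu
    have e : u - w = (u - v) - (w - v) := by abel
    rw [e, norm_sub_sq_real (u - v), real_inner_comm, norm_sub_rev v w]
    linarith [h u hu]
  ext u
  rw [tangentProj, mem_nearest_iff, mem_singleton_iff]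
  constructor
  · rintro ⟨hu, hmin⟩
    have h1 := pow_le_pow_left₀ (norm_nonneg _) (hmin v hv) 2
    have h2 := key u hu
    have h3 : ‖u - v‖ ^ 2 ≤ 0 := by linarith
    have h4 : ‖u - v‖ = 0 := pow_eq_zero_iff two_ne_zero |>.1 (le_antisymm h3 (sq_nonneg _))
    exact sub_eq_zero.1 (norm_eq_zero.1 h4)
  · rintro rfl
    refine ⟨hv, fun q hq => ?_⟩
    refine le_of_sq_le_sq ?_ (norm_nonneg _)
    linarith [key q hq, sq_nonneg ‖q - u‖]

/-- The velocity of a curve in a prox-regular set is orthogonal to the proximal normals. -/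
theorem inner_deriv_eq_zero {x : ℝ → Space d} {v w : Space d} {t C : ℝ}
    (hx : HasDerivAt x v t) (hmem : ∀ᶠ s in 𝓝 t, x s ∈ S)
    (hw : ∀ y ∈ S, ⟪w, y - x t⟫ ≤ C * ‖y - x t‖ ^ 2) : ⟪w, v⟫ = 0 := by
  have h1 : HasDerivAt (fun s => x s - x t) v t := hx.sub_const _
  have h2 : HasDerivAt (fun s => ⟪w, x s - x t⟫ - C * ‖x s - x t‖ ^ 2) ⟪w, v⟫ t := by
    refine (((hasDerivAt_const t w).inner ℝ h1).sub (h1.norm_sq.const_mul C)).congr_deriv ?_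
    simp
  -- The function is nonpositive near `t` and vanishes at `t`; the two-sided derivative gives
  -- equality.
  refine IsLocalMax.hasDerivAt_eq_zero ?_ h2
  filter_upwards [hmem] with s hs
  have := hw _ hs
  simp only [sub_self, inner_zero_right, norm_zero]
  linarith

/-- If the velocity of a curve in a prox-regular set differs from `w` by a proximal normal, then
it is the tangential projection of `w`. -/
theorem IsProxRegular.tangentProj_eq_singleton {η : ℝ} (hη : 0 < η) (hS : IsProxRegular η S)
    {x : ℝ → Space d} {v w : Space d} {t C : ℝ} (hx : HasDerivAt x v t)
    (hmem : ∀ᶠ s in 𝓝 t, x s ∈ S)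
    (hw : ∀ y ∈ S, ⟪w - v, y - x t⟫ ≤ C * ‖y - x t‖ ^ 2) :
    tangentProj S (x t) w = {v} := by
  refine ProxFlow.tangentProj_eq_singleton
    (hS.mem_clarkeTangentCone hη fun q D hq => (inner_deriv_eq_zero hx hmem hq).le) fun u hu => ?_
  rw [inner_sub_right, inner_deriv_eq_zero hx hmem hw, sub_zero]
  exact inner_nonpos_of_mem_clarkeTangentCone hmem.self_of_nhds hw hu

end Geometry

end ProxFlow

namespace ProxFlow

/-! ### The catching-up scheme and its uniform estimates -/

section CatchingUp

variable {d n : ℕ} {S : Set (Space d)}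

theorem norm_sub_le_of_mem_nearest {a u q : Space d} (ha : a ∈ S) (hq : q ∈ nearest S (a + u)) :
    ‖a + u - q‖ ≤ ‖u‖ := by
  have := (mem_nearest_iff.1 hq).2 a ha
  rwa [sub_add_cancel_left, norm_neg, norm_sub_rev] at this

/-- One step of the catching-up scheme satisfies a discrete evolution variational inequality. -/
theorem IsProxRegular.half_sq_sub_le {η : ℝ} (hη : 0 < η) (hS : IsProxRegular η S)
    {a u q y : Space d} (ha : a ∈ S) (hq : q ∈ nearest S (a + u)) (hy : y ∈ S) :
    ‖q - y‖ ^ 2 / 2 - ‖a - y‖ ^ 2 / 2 ≤ ⟪u, q - y⟫ + ‖u‖ / (2 * η) * ‖q - y‖ ^ 2 := by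
  have h1 : ⟪a + u - q, y - q⟫ ≤ ‖a + u - q‖ / (2 * η) * ‖y - q‖ ^ 2 :=
    hS.inner_le hη (by rwa [add_sub_cancel]) hy
  have h2 : ‖a + u - q‖ / (2 * η) * ‖y - q‖ ^ 2 ≤ ‖u‖ / (2 * η) * ‖y - q‖ ^ 2 := by
    have := norm_sub_le_of_mem_nearest ha hq
    gcongr
  have e1 : a - y = (a - q) + (q - y) := by abel
  have e2 : ‖a - y‖ ^ 2 = ‖a - q‖ ^ 2 + 2 * ⟪a - q, q - y⟫ + ‖q - y‖ ^ 2 := by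
    rw [e1, norm_add_sq_real]
  have e3 : ⟪a + u - q, y - q⟫ = -⟪a - q, q - y⟫ - ⟪u, q - y⟫ := by
    rw [← neg_sub q y, inner_neg_right, add_sub_right_comm, inner_add_left]
    ring
  rw [norm_sub_rev y q] at h1 h2
  -- Only the favourable term `-‖a - q‖ ^ 2 / 2` is discarded.
  nlinarith [sq_nonneg ‖a - q‖]

/-- The catching-up scheme with step `h` for the field `F`; `p` selects a nearest point. -/
def catchUp (p : Space d → Space d) (F : (Fin n → Space d) → Fin n → Space d) (h : ℝ)
    (x₀ : Fin n → Space d) : ℕ → Fin n → Space d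
  | 0 => x₀
  | k + 1 => fun i => p (catchUp p F h x₀ k i + h • F (catchUp p F h x₀ k) i)

variable {p : Space d → Space d} {F : (Fin n → Space d) → Fin n → Space d} {h A : ℝ}
  {x₀ : Fin n → Space d}

theorem catchUp_mem (hp : ∀ y, p y ∈ nearest S y) (hx₀ : ∀ i, x₀ i ∈ S) (k : ℕ) (i : Fin n) :
    catchUp p F h x₀ k i ∈ S := by
  cases k with
  | zero => exact hx₀ i
  | succ k => exact (hp _).1

/-- The factor 2 arises because a step is the free displacement minus a correction that is no longer
than it. -/
theorem norm_catchUp_succ_sub_le (hp : ∀ y, p y ∈ nearest S y) (hx₀ : ∀ i, x₀ i ∈ S) (hA : 0 ≤ A)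
    (hF : ∀ x, (∀ i, x i ∈ S) → ∀ i, ‖F x i‖ ≤ A * (1 + ‖x‖)) (hh : 0 ≤ h) (k : ℕ) :
    ‖catchUp p F h x₀ (k + 1) - catchUp p F h x₀ k‖ ≤
      2 * A * h * (1 + ‖catchUp p F h x₀ k‖) := by
  set X := catchUp p F h x₀ k with hX
  refine (pi_norm_le_iff_of_nonneg (by positivity)).2 fun i => ?_
  have hmem : ∀ i, X i ∈ S := catchUp_mem hp hx₀ k
  have h1 := norm_sub_le_of_mem_nearest (hmem i) (hp (X i + h • F X i))
  have h2 : ‖h • F X i‖ ≤ h * (A * (1 + ‖X‖)) := by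
    rw [norm_smul, Real.norm_eq_abs, abs_of_nonneg hh]
    exact mul_le_mul_of_nonneg_left (hF X hmem i) hh
  have e : (catchUp p F h x₀ (k + 1) - X) i =
      h • F X i - (X i + h • F X i - p (X i + h • F X i)) := by
    simp only [Pi.sub_apply, catchUp, ← hX]
    abel
  rw [e]
  refine (norm_sub_le _ _).trans ?_
  linarith

/-- Discrete Grönwall, through `1 + s ≤ exp s`. -/
theorem one_add_norm_catchUp_le (hp : ∀ y, p y ∈ nearest S y) (hx₀ : ∀ i, x₀ i ∈ S) (hA : 0 ≤ A)
    (hF : ∀ x, (∀ i, x i ∈ S) → ∀ i, ‖F x i‖ ≤ A * (1 + ‖x‖)) (hh : 0 ≤ h) (k : ℕ) :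
    1 + ‖catchUp p F h x₀ k‖ ≤ (1 + ‖x₀‖) * Real.exp (2 * A * (k * h)) := by
  induction k with
  | zero => simp [catchUp]
  | succ k ih =>
    have h1 := norm_catchUp_succ_sub_le hp hx₀ hA hF hh k
    have h2 := norm_le_norm_add_norm_sub' (catchUp p F h x₀ (k + 1)) (catchUp p F h x₀ k)
    have h3 : 2 * A * h + 1 ≤ Real.exp (2 * A * h) := Real.add_one_le_exp _
    have e : Real.exp (2 * A * ((k + 1 : ℕ) * h)) =
        Real.exp (2 * A * (k * h)) * Real.exp (2 * A * h) := by
      rw [← Real.exp_add]; congr 1; push_cast; ring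
    rw [e, ← mul_assoc]
    calc 1 + ‖catchUp p F h x₀ (k + 1)‖
        ≤ (1 + ‖catchUp p F h x₀ k‖) * (2 * A * h + 1) := by linarith
      _ ≤ _ := by gcongr

/-- The Lipschitz constant is independent of `h`, so it passes to the limit. -/
theorem norm_catchUp_sub_le (hp : ∀ y, p y ∈ nearest S y) (hx₀ : ∀ i, x₀ i ∈ S) (hA : 0 ≤ A)
    (hF : ∀ x, (∀ i, x i ∈ S) → ∀ i, ‖F x i‖ ≤ A * (1 + ‖x‖)) (hh : 0 ≤ h) {k l : ℕ}
    (hkl : k ≤ l) {T : ℝ} (hT : l * h ≤ T) :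
    ‖catchUp p F h x₀ l - catchUp p F h x₀ k‖ ≤
      2 * A * ((1 + ‖x₀‖) * Real.exp (2 * A * T)) * (l * h - k * h) := by
  induction l, hkl using Nat.le_induction with
  | base => simp
  | succ l hkl ih =>
    have hlT : l * h ≤ T := by
      push_cast at hT; linarith
    have h1 := ih hlT
    have h2 := norm_catchUp_succ_sub_le hp hx₀ hA hF hh l
    have h3 : 1 + ‖catchUp p F h x₀ l‖ ≤ (1 + ‖x₀‖) * Real.exp (2 * A * T) :=
      (one_add_norm_catchUp_le hp hx₀ hA hF hh l).trans (by gcongr)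
    have h4 : 2 * A * h * (1 + ‖catchUp p F h x₀ l‖) ≤
        2 * A * h * ((1 + ‖x₀‖) * Real.exp (2 * A * T)) := by gcongr
    have h5 := norm_sub_le_norm_sub_add_norm_sub (catchUp p F h x₀ (l + 1)) (catchUp p F h x₀ l)
      (catchUp p F h x₀ k)
    push_cast
    linarith

/-- The evolution variational inequality for the catching-up scheme between two times at which the
right hand side stays below `c`. -/
theorem IsProxRegular.half_sq_catchUp_sub_le {η : ℝ} (hη : 0 < η) (hS : IsProxRegular η S)
    (hp : ∀ y, p y ∈ nearest S y) (hx₀ : ∀ i, x₀ i ∈ S) (hh : 0 ≤ h) {i : Fin n} {y : Space d}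
    (hy : y ∈ S) {k l : ℕ} (hkl : k ≤ l) {M c : ℝ}
    (hM : ∀ j < l, ‖F (catchUp p F h x₀ j) i‖ ≤ M)
    (hc : ∀ j, k ≤ j → j < l → ⟪F (catchUp p F h x₀ j) i, catchUp p F h x₀ (j + 1) i - y⟫ +
      M / (2 * η) * ‖catchUp p F h x₀ (j + 1) i - y‖ ^ 2 ≤ c) :
    ‖catchUp p F h x₀ l i - y‖ ^ 2 / 2 - ‖catchUp p F h x₀ k i - y‖ ^ 2 / 2 ≤
      (l * h - k * h) * c := by
  induction l, hkl using Nat.le_induction with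
  | base => simp
  | succ l hkl ih =>
    have h1 := ih (fun j hj => hM j (hj.trans l.lt_succ_self))
      fun j hj hj' => hc j hj (hj'.trans l.lt_succ_self)
    have h2 : ‖catchUp p F h x₀ (l + 1) i - y‖ ^ 2 / 2 - ‖catchUp p F h x₀ l i - y‖ ^ 2 / 2 ≤ _ :=
      hS.half_sq_sub_le hη (catchUp_mem hp hx₀ l i)
        (hp (catchUp p F h x₀ l i + h • F (catchUp p F h x₀ l) i)) hy
    change _ ≤ ⟪h • F (catchUp p F h x₀ l) i, catchUp p F h x₀ (l + 1) i - y⟫ +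
      ‖h • F (catchUp p F h x₀ l) i‖ / (2 * η) * ‖catchUp p F h x₀ (l + 1) i - y‖ ^ 2 at h2
    rw [real_inner_smul_left, norm_smul, Real.norm_eq_abs, abs_of_nonneg hh] at h2
    have h3 : h * ‖F (catchUp p F h x₀ l) i‖ / (2 * η) * ‖catchUp p F h x₀ (l + 1) i - y‖ ^ 2 ≤
        h * M / (2 * η) * ‖catchUp p F h x₀ (l + 1) i - y‖ ^ 2 := by
      have := hM l l.lt_succ_self
      gcongr
    have h4 := mul_le_mul_of_nonneg_left (hc l hkl l.lt_succ_self) hh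
    push_cast
    have e : h * M / (2 * η) * ‖catchUp p F h x₀ (l + 1) i - y‖ ^ 2 =
      h * (M / (2 * η) * ‖catchUp p F h x₀ (l + 1) i - y‖ ^ 2) := by ring
    linarith

/-! ### Vanishing mesh and the limit curve -/

/-- The number of the grid point of mesh `1 / (N + 1)` preceding `t`. -/
noncomputable def gridIndex (N : ℕ) (t : ℝ) : ℕ := ⌊t * (N + 1)⌋₊

theorem gridIndex_zero (N : ℕ) : gridIndex N 0 = 0 := by simp [gridIndex]

theorem gridIndex_mono (N : ℕ) {s t : ℝ} (hst : s ≤ t) : gridIndex N s ≤ gridIndex N t :=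
  Nat.floor_mono (by gcongr)

theorem gridIndex_mul_le (N : ℕ) {t : ℝ} (ht : 0 ≤ t) :
    gridIndex N t * ((N : ℝ) + 1)⁻¹ ≤ t := by
  rw [← div_eq_mul_inv, div_le_iff₀ (by positivity)]
  exact Nat.floor_le (by positivity)

theorem lt_gridIndex_mul (N : ℕ) (t : ℝ) :
    t < gridIndex N t * ((N : ℝ) + 1)⁻¹ + ((N : ℝ) + 1)⁻¹ := by
  rw [← add_one_mul, ← div_eq_mul_inv, lt_div_iff₀ (by positivity)]
  exact Nat.lt_floor_add_one _

theorem tendsto_mesh : Tendsto (fun N : ℕ => ((N : ℝ) + 1)⁻¹) atTop (𝓝 0) := by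
  simpa using tendsto_one_div_add_atTop_nhds_zero_nat (𝕜 := ℝ)

theorem tendsto_gridIndex_mul {t : ℝ} (ht : 0 ≤ t) :
    Tendsto (fun N : ℕ => gridIndex N t * ((N : ℝ) + 1)⁻¹) atTop (𝓝 t) := by
  refine tendsto_of_tendsto_of_tendsto_of_le_of_le (g := fun N : ℕ => t - ((N : ℝ) + 1)⁻¹)
    (by simpa using (tendsto_const_nhds (x := t)).sub tendsto_mesh) tendsto_const_nhds
    (fun N => ?_) fun N => gridIndex_mul_le N ht
  have := lt_gridIndex_mul N t
  dsimp only
  linarith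

theorem norm_catchUp_gridIndex_sub_le (hp : ∀ y, p y ∈ nearest S y) (hx₀ : ∀ i, x₀ i ∈ S)
    (hA : 0 ≤ A) (hF : ∀ x, (∀ i, x i ∈ S) → ∀ i, ‖F x i‖ ≤ A * (1 + ‖x‖)) (N : ℕ) {s t T : ℝ}
    (hs : 0 ≤ s) (hst : s ≤ t) (ht : t ≤ T) :
    ‖catchUp p F ((N : ℝ) + 1)⁻¹ x₀ (gridIndex N t) -
        catchUp p F ((N : ℝ) + 1)⁻¹ x₀ (gridIndex N s)‖ ≤
      2 * A * ((1 + ‖x₀‖) * Real.exp (2 * A * T)) * (t - s + ((N : ℝ) + 1)⁻¹) := by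
  have hle := gridIndex_mul_le N (hs.trans hst)
  refine (norm_catchUp_sub_le hp hx₀ hA hF (by positivity) (gridIndex_mono N hst)
    (hle.trans ht)).trans ?_
  have := lt_gridIndex_mul N s
  gcongr
  linarith

/-- Pointwise limits along an ultrafilter of the catching-up approximations. -/
theorem exists_tendsto_catchUp (hp : ∀ y, p y ∈ nearest S y) (hx₀ : ∀ i, x₀ i ∈ S) (hA : 0 ≤ A)
    (hF : ∀ x, (∀ i, x i ∈ S) → ∀ i, ‖F x i‖ ≤ A * (1 + ‖x‖)) :
    ∃ x : ℝ → Fin n → Space d, ∀ t, Tendsto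
      (fun N : ℕ => catchUp p F ((N : ℝ) + 1)⁻¹ x₀ (gridIndex N t)) (hyperfilter ℕ) (𝓝 (x t)) := by
  suffices hex : ∀ t, ∃ z, Tendsto
      (fun N : ℕ => catchUp p F ((N : ℝ) + 1)⁻¹ x₀ (gridIndex N t)) (hyperfilter ℕ) (𝓝 z) by
    choose x hx using hex
    exact ⟨x, hx⟩
  intro t
  -- Negative times have grid index 0, whence `max t 0`. Boundedness at each time suffices, as one
  -- ultrafilter serves all times and no subsequence is extracted.
  set R := (1 + ‖x₀‖) * Real.exp (2 * A * max t 0)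
  have hmem : ∀ N : ℕ, catchUp p F ((N : ℝ) + 1)⁻¹ x₀ (gridIndex N t) ∈
      Metric.closedBall (0 : Fin n → Space d) R := fun N => by
    have h1 : gridIndex N t * ((N : ℝ) + 1)⁻¹ ≤ max t 0 := by
      refine le_trans ?_ (gridIndex_mul_le N (le_max_right t 0))
      gcongr
      exact gridIndex_mono N (le_max_left _ _)
    have h2 : 1 + ‖catchUp p F ((N : ℝ) + 1)⁻¹ x₀ (gridIndex N t)‖ ≤ R :=
      (one_add_norm_catchUp_le hp hx₀ hA hF (by positivity) _).trans
        (mul_le_mul_of_nonneg_left (Real.exp_le_exp.2 (by gcongr)) (by positivity))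
    rw [mem_closedBall_zero_iff]
    linarith
  obtain ⟨x, -, hx⟩ := (isCompact_closedBall (0 : Fin n → Space d) R).ultrafilter_le_nhds
    ((hyperfilter ℕ).map fun N : ℕ => catchUp p F ((N : ℝ) + 1)⁻¹ x₀ (gridIndex N t))
    (tendsto_principal.2 (Eventually.of_forall hmem))
  exact ⟨x, hx⟩

/-- By continuity the bound `c` holds near `x t₀`, and the uniform Lipschitz estimate keeps the
scheme there for a short time. The constant `M` bounds the field along the scheme up to time `t₀ +
1`. -/
theorem exists_half_sq_sub_le {η : ℝ} (hη : 0 < η) (hS : IsProxRegular η S)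
    (hp : ∀ y, p y ∈ nearest S y) (hx₀ : ∀ i, x₀ i ∈ S) (hA : 0 ≤ A)
    (hF : ∀ x, (∀ i, x i ∈ S) → ∀ i, ‖F x i‖ ≤ A * (1 + ‖x‖)) (hFc : Continuous F)
    {x : ℝ → Fin n → Space d} (hx : ∀ t, Tendsto
      (fun N : ℕ => catchUp p F ((N : ℝ) + 1)⁻¹ x₀ (gridIndex N t)) (hyperfilter ℕ) (𝓝 (x t)))
    {t₀ : ℝ} (ht₀ : 0 ≤ t₀) {M c : ℝ}
    (hM : M = A * ((1 + ‖x₀‖) * Real.exp (2 * A * (t₀ + 1)))) {i : Fin n} {y : Space d} (hy : y ∈ S)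
    (hc : ⟪F (x t₀) i, x t₀ i - y⟫ + M / (2 * η) * ‖x t₀ i - y‖ ^ 2 < c) :
    ∃ δ > 0, ∀ t, t₀ ≤ t → t < t₀ + δ →
      ‖x t i - y‖ ^ 2 / 2 - ‖x t₀ i - y‖ ^ 2 / 2 ≤ (t - t₀) * c := by
  -- Two arguments are needed: the scheme evaluates `F` at step `j` and the distance to `y` at step
  -- `j + 1`.
  have hG : Continuous fun z : (Fin n → Space d) × (Fin n → Space d) =>
      ⟪F z.1 i, z.2 i - y⟫ + M / (2 * η) * ‖z.2 i - y‖ ^ 2 := by fun_prop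
  obtain ⟨ρ, hρ, hball⟩ := Metric.eventually_nhds_iff.1
    (hG.continuousAt.eventually_lt (continuousAt_const (x := (x t₀, x t₀))) hc)
  set K := 2 * A * ((1 + ‖x₀‖) * Real.exp (2 * A * (t₀ + 1))) with hK
  have hK0 : 0 ≤ K := by positivity
  -- Half of `ρ` is left for the drift `K * δ`, the other half for the error at time `t₀`.
  set δ := min 1 (ρ / (4 * (K + 1))) with hδ
  have hδ0 : 0 < δ := by positivity
  have hKδ : K * δ < ρ / 2 := by
    have h1 : δ * (4 * (K + 1)) ≤ ρ := by
      rw [← le_div_iff₀ (by positivity)]; exact min_le_right _ _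
    nlinarith
  refine ⟨δ, hδ0, fun t ht htδ => ?_⟩
  have ht1 : t ≤ t₀ + 1 := by linarith [min_le_left 1 (ρ / (4 * (K + 1)))]
  have hU := Nat.hyperfilter_le_atTop
  have hnear : ∀ᶠ N : ℕ in hyperfilter ℕ,
      dist (catchUp p F ((N : ℝ) + 1)⁻¹ x₀ (gridIndex N t₀)) (x t₀) < ρ / 2 :=
    Metric.tendsto_nhds.1 (hx t₀) _ (half_pos hρ)
  have hev : ∀ᶠ N : ℕ in hyperfilter ℕ,
      ‖catchUp p F ((N : ℝ) + 1)⁻¹ x₀ (gridIndex N t) i - y‖ ^ 2 / 2 -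
        ‖catchUp p F ((N : ℝ) + 1)⁻¹ x₀ (gridIndex N t₀) i - y‖ ^ 2 / 2 ≤
      (gridIndex N t * ((N : ℝ) + 1)⁻¹ - gridIndex N t₀ * ((N : ℝ) + 1)⁻¹) * c := by
    -- The grid point before `t₀` may precede it by up to one mesh; this slack keeps the elapsed
    -- time below `δ`.
    have hmesh : ∀ᶠ N : ℕ in hyperfilter ℕ, ((N : ℝ) + 1)⁻¹ < t₀ + δ - t :=
      (tendsto_mesh.mono_left hU).eventually (gt_mem_nhds (by linarith))
    filter_upwards [hnear, hmesh] with N hN hmN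
    have hh : (0 : ℝ) ≤ ((N : ℝ) + 1)⁻¹ := by positivity
    have hle := gridIndex_mul_le N (ht₀.trans ht)
    have hlt := lt_gridIndex_mul N t₀
    have hjT : ∀ j ≤ gridIndex N t, j * ((N : ℝ) + 1)⁻¹ ≤ t := fun j hj =>
      le_trans (by gcongr) hle
    have hclose : ∀ j, gridIndex N t₀ ≤ j → j ≤ gridIndex N t →
        dist (catchUp p F ((N : ℝ) + 1)⁻¹ x₀ j) (x t₀) < ρ := fun j hj hj' => by
      have h1 := norm_catchUp_sub_le hp hx₀ hA hF hh hj ((hjT j hj').trans ht1)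
      have h2 : K * (j * ((N : ℝ) + 1)⁻¹ - gridIndex N t₀ * ((N : ℝ) + 1)⁻¹) ≤ K * δ := by
        have := hjT j hj'
        gcongr
        linarith
      have h3 := dist_triangle (catchUp p F ((N : ℝ) + 1)⁻¹ x₀ j)
        (catchUp p F ((N : ℝ) + 1)⁻¹ x₀ (gridIndex N t₀)) (x t₀)
      rw [← dist_eq_norm, ← hK] at h1
      linarith
    refine hS.half_sq_catchUp_sub_le hη hp hx₀ hh hy (gridIndex_mono N ht) (M := M)
      (fun j hj => ?_) fun j hj hj' => (hball (y := (_, _)) ?_).le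
    · rw [hM]
      refine (hF _ (catchUp_mem hp hx₀ j) i).trans ?_
      have h1 := one_add_norm_catchUp_le hp hx₀ hA hF hh j
      have h2 := (hjT j hj.le).trans ht1
      gcongr
      exact h1.trans (by gcongr)
    · rw [Prod.dist_eq, max_lt_iff]
      exact ⟨hclose j hj hj'.le, hclose (j + 1) (hj.trans j.le_succ) hj'⟩
  have hxi : ∀ t, Tendsto (fun N : ℕ => ‖catchUp p F ((N : ℝ) + 1)⁻¹ x₀ (gridIndex N t) i - y‖ ^ 2
      / 2) (hyperfilter ℕ) (𝓝 (‖x t i - y‖ ^ 2 / 2)) := fun t =>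
    ((((tendsto_pi_nhds.1 (hx t) i).sub_const y).norm.pow 2).div_const 2)
  exact le_of_tendsto_of_tendsto ((hxi t).sub (hxi t₀))
    ((((tendsto_gridIndex_mul (ht₀.trans ht)).sub (tendsto_gridIndex_mul ht₀)).mono_left
      hU).mul_const c) hev

/-- Existence of Lipschitz curves in a prox-regular set driven by a continuous field, up to
proximal normals. -/
theorem IsProxRegular.exists_curve {η : ℝ} (hη : 0 < η) (hS : IsProxRegular η S)
    (hne : S.Nonempty) (hx₀ : ∀ i, x₀ i ∈ S) (hA : 0 ≤ A)
    (hF : ∀ x, (∀ i, x i ∈ S) → ∀ i, ‖F x i‖ ≤ A * (1 + ‖x‖)) (hFc : Continuous F) :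
    ∃ x : ℝ → Fin n → Space d, x 0 = x₀ ∧ (∀ t i, x t i ∈ S) ∧
      (∀ T, ∃ K, LipschitzOnWith K x (Icc 0 T)) ∧
      ∀ t, 0 ≤ t → ∃ C : ℝ, ∀ i v, HasDerivAt (fun s => x s i) v t →
        ∀ y ∈ S, ⟪F (x t) i - v, y - x t i⟫ ≤ C * ‖y - x t i‖ ^ 2 := by
  choose p hp using exists_mem_nearest hS.isClosed hne
  obtain ⟨x, hx⟩ := exists_tendsto_catchUp hp hx₀ hA hF
  refine ⟨x, ?_, fun t i => ?_, fun T => ?_, fun t ht => ?_⟩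
  · refine tendsto_nhds_unique (hx 0) ?_
    simp only [gridIndex_zero]
    exact tendsto_const_nhds
  · exact hS.isClosed.mem_of_tendsto (tendsto_pi_nhds.1 (hx t) i)
      (Eventually.of_forall fun N => catchUp_mem hp hx₀ _ i)
  · set K := 2 * A * ((1 + ‖x₀‖) * Real.exp (2 * A * T)) with hK
    have hK0 : 0 ≤ K := by positivity
    have key : ∀ s t, 0 ≤ s → s ≤ t → t ≤ T → ‖x t - x s‖ ≤ K * (t - s) := by
      intro s t hs hst ht
      have h1 : Tendsto (fun N : ℕ => K * (t - s + ((N : ℝ) + 1)⁻¹)) (hyperfilter ℕ)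
          (𝓝 (K * (t - s + 0))) :=
        (((tendsto_mesh.mono_left Nat.hyperfilter_le_atTop).const_add _).const_mul _)
      rw [add_zero] at h1
      exact le_of_tendsto_of_tendsto' ((hx t).sub (hx s)).norm h1 fun N =>
        norm_catchUp_gridIndex_sub_le hp hx₀ hA hF N hs hst ht
    refine ⟨K.toNNReal, LipschitzOnWith.of_dist_le_mul fun s hs t ht => ?_⟩
    rw [Real.coe_toNNReal _ hK0]
    rcases le_total s t with hst | hst
    · rw [dist_comm, dist_comm s, dist_eq_norm, Real.dist_eq, abs_of_nonneg (sub_nonneg.2 hst)]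
      exact key s t hs.1 hst ht.2
    · rw [dist_eq_norm, Real.dist_eq, abs_of_nonneg (sub_nonneg.2 hst)]
      exact key t s ht.1 hst hs.2
  · set M := A * ((1 + ‖x₀‖) * Real.exp (2 * A * (t + 1))) with hM
    refine ⟨M / (2 * η), fun i v hv y hy => ?_⟩
    have hd : HasDerivAt (fun s => ‖x s i - y‖ ^ 2 / 2) ⟪x t i - y, v⟫ t :=
      ((hv.sub_const y).norm_sq.div_const 2).congr_deriv (by ring)
    have hle : ⟪x t i - y, v⟫ ≤ ⟪F (x t) i, x t i - y⟫ + M / (2 * η) * ‖x t i - y‖ ^ 2 := by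
      -- For each `c` above the right-hand side, the difference quotients to the right of `t` are
      -- eventually at most `c`.
      refine le_of_forall_gt_imp_ge_of_dense fun c hc => ?_
      obtain ⟨δ, hδ, hδ'⟩ := exists_half_sq_sub_le hη hS hp hx₀ hA hF hFc hx ht hM hy hc
      refine le_of_tendsto (hd.tendsto_slope.mono_left
        (nhdsWithin_mono (s := Ioi t) t fun s hs => ne_of_gt hs)) ?_
      filter_upwards [Ioo_mem_nhdsGT (show t < t + δ by linarith)] with s hs
      rw [slope_def_field, div_le_iff₀ (sub_pos.2 hs.1), mul_comm c]
      exact hδ' s hs.1.le hs.2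
    have e : ⟪F (x t) i - v, y - x t i⟫ = ⟪x t i - y, v⟫ - ⟪F (x t) i, x t i - y⟫ := by
      rw [← neg_sub (x t i) y, inner_neg_right, inner_sub_left, real_inner_comm v]
      ring
    rw [e, norm_sub_rev]
    linarith

theorem IsProxRegular.exists_isSolution {η : ℝ} (hη : 0 < η) (hS : IsProxRegular η S)
    {W V : Space d → ℝ} {m : Fin n → ℝ} (hFc : Continuous (velocity W V m))
    (hne : S.Nonempty) (hx₀ : ∀ i, x₀ i ∈ S) (hA : 0 ≤ A)
    (hF : ∀ x, (∀ i, x i ∈ S) → ∀ i, ‖velocity W V m x i‖ ≤ A * (1 + ‖x‖)) :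
    ∃ x : ℝ → Fin n → Space d, IsSolution S W V m x₀ x := by
  obtain ⟨x, hx0, hmem, hlip, hx⟩ := hS.exists_curve hη hne hx₀ hA hF hFc
  refine ⟨x, fun i T hT => ?_, fun t _ => hmem t, hx0, ?_⟩
  · obtain ⟨K, hK⟩ := hlip T
    rw [← uIcc_of_le hT] at hK
    exact ((LipschitzWith.eval i).comp_lipschitzOnWith hK).absolutelyContinuousOnInterval
  -- Lipschitz curves are differentiable almost everywhere. Time 0 is discarded since orthogonality
  -- to normals needs a two-sided derivative.
  · have hdiff : ∀ᵐ t : ℝ, ∀ k : ℕ, t ∈ Icc (0 : ℝ) k → DifferentiableWithinAt ℝ x (Icc 0 k) t :=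
      ae_all_iff.2 fun k => (hlip k).choose_spec.ae_differentiableWithinAt_of_mem_real
    have h0 : ∀ᵐ t : ℝ, t ≠ 0 := by simp [ae_iff]
    rw [ae_restrict_iff' measurableSet_Ici]
    filter_upwards [hdiff, h0] with t ht ht0 htmem i
    have htpos : 0 < t := lt_of_le_of_ne htmem ht0.symm
    obtain ⟨k, hk⟩ := exists_nat_gt t
    have hd : DifferentiableAt ℝ x t :=
      (ht k ⟨htpos.le, hk.le⟩).differentiableAt (Icc_mem_nhds htpos hk)
    have hdi := hasDerivAt_pi.1 hd.hasDerivAt i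
    obtain ⟨C, hC⟩ := hx t htpos.le
    exact ⟨_, hdi, hS.tangentProj_eq_singleton hη hdi (Eventually.of_forall fun s => hmem s i)
      (hC i _ hdi)⟩

end CatchingUp

/-! ### Continuity and growth of the particle velocity -/

section Field

variable {d n : ℕ} {W V : Space d → ℝ} {m : Fin n → ℝ}

theorem _root_.ContDiff.continuous_gradient {f : Space d → ℝ} (hf : ContDiff ℝ 1 f) :
    Continuous (∇ f) :=
  (InnerProductSpace.toDual ℝ (Space d)).symm.continuous.comp (hf.continuous_fderiv one_ne_zero)

theorem continuous_velocity (hW : ContDiff ℝ 1 W) (hV : ContDiff ℝ 1 V) :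
    Continuous (velocity W V m) := by
  have h1 := hW.continuous_gradient
  have h2 := hV.continuous_gradient
  unfold velocity
  fun_prop

theorem exists_norm_velocity_le_of_isBounded {S : Set (Space d)}
    (hF : Continuous (velocity W V m)) (hS : Bornology.IsBounded S) :
    ∃ A, 0 ≤ A ∧ ∀ x : Fin n → Space d, (∀ i, x i ∈ S) →
      ∀ i, ‖velocity W V m x i‖ ≤ A * (1 + ‖x‖) := by
  -- The velocity is continuous on the compact power of the closure of `S`.
  obtain ⟨A, hA⟩ := ((isCompact_univ_pi fun _ : Fin n => hS.isCompact_closure).image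
    hF).isBounded.exists_norm_le
  refine ⟨max A 0, le_max_right _ _, fun x hx i => ?_⟩
  have h1 := hA _ (mem_image_of_mem (velocity W V m)
    (mem_univ_pi.2 fun i => subset_closure (hx i)))
  calc ‖velocity W V m x i‖ ≤ ‖velocity W V m x‖ := norm_le_pi_norm _ i
    _ ≤ max A 0 * 1 := by rw [mul_one]; exact h1.trans (le_max_left _ _)
    _ ≤ _ := by
      gcongr
      linarith [norm_nonneg x]

theorem exists_norm_velocity_le_of_gradLinearGrowth (hW : GradLinearGrowth W)
    (hV : GradLinearGrowth V) (hm : ∀ i, 0 ≤ m i) (hm_sum : ∑ i, m i = 1) :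
    ∃ A, 0 ≤ A ∧ ∀ (x : Fin n → Space d) i, ‖velocity W V m x i‖ ≤ A * (1 + ‖x‖) := by
  obtain ⟨C, hC, hWC⟩ := hW
  obtain ⟨D, hD, hVD⟩ := hV
  -- The 2 comes from `‖x i - x j‖ ≤ 2 * ‖x‖`; the masses average to one.
  refine ⟨2 * C + D, by positivity, fun x i => ?_⟩
  have hx : ∀ i, ‖x i‖ ≤ ‖x‖ := norm_le_pi_norm x
  have h1 : ‖∑ j, m j • ∇ W (x i - x j)‖ ≤ 2 * C * (1 + ‖x‖) := by
    calc ‖∑ j, m j • ∇ W (x i - x j)‖ ≤ ∑ j, m j * (2 * C * (1 + ‖x‖)) := by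
          refine norm_sum_le_of_le _ fun j _ => ?_
          rw [norm_smul, Real.norm_eq_abs, abs_of_nonneg (hm j)]
          refine mul_le_mul_of_nonneg_left ((hWC _).trans ?_) (hm j)
          have := (norm_sub_le (x i) (x j)).trans (add_le_add (hx i) (hx j))
          nlinarith
      _ = _ := by rw [← Finset.sum_mul, hm_sum, one_mul]
  have h2 : ‖∇ V (x i)‖ ≤ D * (1 + ‖x‖) := (hVD _).trans (by gcongr; exact hx i)
  calc ‖velocity W V m x i‖ ≤ ‖-∑ j, m j • ∇ W (x i - x j)‖ + ‖∇ V (x i)‖ := norm_sub_le _ _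
    _ ≤ _ := by rw [norm_neg]; linarith

end Field

end ProxFlow

theorem theorem2p6 {d : ℕ} (Ω : Set (ProxFlow.Space d)) (η : ℝ) (hη : 0 < η)
    (hΩ : ProxFlow.IsProxRegular η Ω)
    (W V : ProxFlow.Space d → ℝ) (hW : ContDiff ℝ 1 W) (hV : ContDiff ℝ 1 V)
    (h : (Bornology.IsBounded Ω ∧
            (∃ lamW : ℝ, ProxFlow.GeodConvexOn lamW W (ProxFlow.conv (Ω - Ω))) ∧
            (∃ lamV : ℝ, ProxFlow.GeodConvexOn lamV V (ProxFlow.conv Ω))) ∨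
          (ProxFlow.GradLinearGrowth W ∧ ProxFlow.GradLinearGrowth V))
    (n : ℕ) (x₀ : Fin n → ProxFlow.Space d) (hx₀ : ∀ i, x₀ i ∈ Ω)
    (m : Fin n → ℝ) (hm : ∀ i, 0 ≤ m i) (hm_sum : ∑ i, m i = 1) :
    ∃ x : ℝ → Fin n → ProxFlow.Space d, ProxFlow.IsSolution Ω W V m x₀ x := by
  have hF := ProxFlow.continuous_velocity (m := m) hW hV
  have hne : Ω.Nonempty := by
    -- Total mass one rules out `n = 0`.
    rcases isEmpty_or_nonempty (Fin n) with _ | ⟨⟨i⟩⟩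
    · simp at hm_sum
    · exact ⟨x₀ i, hx₀ i⟩
  rcases h with ⟨hbdd, -⟩ | ⟨hWg, hVg⟩
  · obtain ⟨A, hA, hbound⟩ := ProxFlow.exists_norm_velocity_le_of_isBounded hF hbdd
    exact hΩ.exists_isSolution hη hF hne hx₀ hA hbound
  · obtain ⟨A, hA, hbound⟩ :=
      ProxFlow.exists_norm_velocity_le_of_gradLinearGrowth hWg hVg hm hm_sum
    exact hΩ.exists_isSolution hη hF hne hx₀ hA fun x _ => hbound x
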